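/- Convention: $F[g](t)=\hat g(t)=\int_{\mathbb R} g(x)e^{-2\pi i x t}\,dx$. Let $m\ge 1$ be an integer and let $Q:\mathbb R\to\mathbb R$ be an integrable even function with $Q(x)>0$ for all $x\ne 0$, such that $$R(x):=\frac{1}{2\pi x\,\bigl(1+(2\pi x)^{2m}\bigr)\,Q(x)}$$ is also integrable on $\mathbb R$. Put $k(t,t')=\hat Q(t-t')=\int_{\mathbb R}Q(\omega)e^{-2\pi i\omega(t-t')}\,d\omega$. Then: 1. $k$ is a real-valued, positive semidefinite, translation-invariant kernel on $\mathbb R$ with $k(t,t)\le\|Q\|_{L^1}$ for all $t$. It is universal: it is continuous and, for every compact $K\subset\mathbb R$, the linear span of $\{k(\cdot,z)|_K : z\in K\}$ is uniformly dense in $C(K)$. 2. The (real) reproducing kernel Hilbert space $\mathcal H$ of $k$ contains every compactly supported $2m$-times differentiable function $f:\mathbb R\to\mathbb R$ whose derivatives $f^{(j)}$, $0\le j\le 2m$, are bounded. For every $T>0$ and every $2m$-times differentiable $f:\mathbb R\to\mathbb R$ that vanishes outside $[0,T+1]$ and belongs to $\mathcal H$ (if $f\notin\mathcal H$ the right-hand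 side below is infinite), $$\|f\|_{\mathcal H}^2\;\le\;c(T)\,\|f'\|_{L^1}\,\bigl\|f+(-1)^m f^{(2m)}\bigr\|_{L^\infty},\qquad c(T):=\|F[R]\|_{L^1([-T-1,\,T+1])}<\infty .$$ (For odd $m$, in particular for $m=1$, the last factor is $\|f-f^{(2m)}\|_{L^\infty}$.) 3. If $R$ is non-increasing on $(0,\infty)$, then for all $T>0$ $$c(T)\;\le\;\inf_{\alpha>0}\;\left(4\pi(T+1)^2\int_0^\alpha R(x)\,x\,dx+\frac4\pi\int_\alpha^\infty\frac{R(x)}{x}\,dx\right).$$ -/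

import Mathlib

open MeasureTheory Set
open scoped FourierTransform ENNReal

noncomputable section

/-- The kernel with spectral density `Q`,
`k(s,t) = ∫ Q(ω) exp (-2πiω(s-t)) dω`. For even `Q` this integral is real. -/
def spectralKernel (Q : ℝ → ℝ) (s t : ℝ) : ℝ :=
  (𝓕 (fun ω : ℝ => (Q ω : ℂ)) (s - t)).re

/-- A real kernel `k` on a topological space is universal if it is continuous and, for every compact
set `K`, the linear span of the sections `k(·, z)`, `z ∈ K`, is uniformly dense in `C(K)`. -/
def IsUniversalKernel {X : Type*} [TopologicalSpace X] (k : X → X → ℝ) : Prop :=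
  Continuous (Function.uncurry k) ∧
    ∀ K : Set X, IsCompact K → ∀ g : X → ℝ, ContinuousOn g K → ∀ ε : ℝ, 0 < ε →
      ∃ h ∈ Submodule.span ℝ ((fun (z : X) (x : X) => k x z) '' K), ∀ x ∈ K, |h x - g x| < ε

/-- The weight `R(x) = 1 / (2πx (1 + (2πx)^(2m)) Q(x))`. -/
def spectralWeight (m : ℕ) (Q : ℝ → ℝ) (x : ℝ) : ℝ :=
  1 / (2 * Real.pi * x * (1 + (2 * Real.pi * x) ^ (2 * m)) * Q x)

/-- The constant `c(T) = ‖𝓕 R‖` in `L¹([-T-1, T+1])`. -/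
def pathConst (m : ℕ) (Q : ℝ → ℝ) (T : ℝ) : ℝ≥0∞ :=
  eLpNorm (𝓕 (fun x : ℝ => (spectralWeight m Q x : ℂ))) 1
    (volume.restrict (Icc (-T - 1) (T + 1)))

/-- `f` is `n` times differentiable (the `n`-th derivative need not be continuous). -/
def TimesDifferentiable (n : ℕ) (f : ℝ → ℝ) : Prop :=
  ∀ j < n, Differentiable ℝ (iteratedDeriv j f)

/-- `H` is a (the) reproducing kernel Hilbert space of real functions with kernel `k`. -/
def HasKernel {X : Type*} (H : Type*) [NormedAddCommGroup H] [InnerProductSpace ℝ H]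
    [CompleteSpace H] [RKHS ℝ H X ℝ] (k : X → X → ℝ) : Prop :=
  ∀ s t : X, RKHS.kernel H s t 1 = k s t

end

/-!
A function `f` with integrable Fourier transform is an inverse Fourier integral, so weighted
Cauchy–Schwarz bounds its pairing with `∑ₜ c t • k(·, t)` by `(∫ |𝓕 f|² / Q)^(1/2)` times the norm
of that sum; by Riesz representation `f` lies in `H` and `‖f‖² ≤ ∫ |𝓕 f|² / Q`.

Let `L f = f + (-1)ᵐ f⁽²ᵐ⁾`. The symbols `2πix` of `d/dx` and `1 + (2πx)²ᵐ` of `L` multiply to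
`i / (R Q)`, so `|𝓕 f|² / Q = -i R · 𝓕 (f') · conj (𝓕 (L f))`. By Parseval the energy is, up to a
unimodular factor, `∫ 𝓕 R · (f' ⋆ L f)`, where the cross-correlation `f' ⋆ L f` is supported in
`[-T - 1, T + 1]` and bounded by `‖f'‖₁ ‖L f‖_∞`.

Universality is a duality statement: a functional `Λ` on `C(K)` annihilating the sections of `k`
satisfies `∫ Q |c|² = 0`, where `c ω` is the value of `Λ` at the character of frequency `ω`. Hence
`Λ` vanishes on all characters, whose span is dense by Stone–Weierstrass.

When `R` is antitone on `(0, ∞)`, its sine transform is nonnegative, hence `|𝓕 R|` can be integrated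
exactly: `c(T) = 4 ∫₀^∞ R(x) (1 - cos (2πx(T + 1))) / (2πx) dx`. The bound follows from
`1 - cos y ≤ y² / 2` for `x ≤ α` and `1 - cos y ≤ 2` for `x > α`.
-/

open Complex (I)
open scoped ComplexConjugate InnerProductSpace Convolution

section Fourier

variable {V : Type*} [NormedAddCommGroup V] [InnerProductSpace ℝ V] [MeasurableSpace V]
  [BorelSpace V] [FiniteDimensional ℝ V]

variable {E : Type*} [NormedAddCommGroup E] [NormedSpace ℂ E]

theorem norm_fourier_le (f : V → E) (w : V) : ‖𝓕 f w‖ ≤ ∫ v, ‖f v‖ :=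
  VectorFourier.norm_fourierIntegral_le_integral_norm _ _ _ _ _

theorem continuous_fourier_of_integrable {f : V → E} (hf : Integrable f) : Continuous (𝓕 f) :=
  VectorFourier.fourierIntegral_continuous Real.continuous_fourierChar continuous_inner hf

theorem integral_fourier_mul {f g : V → ℂ} (hf : Integrable f) (hg : Integrable g) :
    ∫ w, 𝓕 f w * g w = ∫ v, f v * 𝓕 g v := by
  have h := VectorFourier.integral_fourierIntegral_smul_eq_flip (L := innerₗ V)
    Real.continuous_fourierChar continuous_inner hf hg
  rwa [flip_innerₗ] at h

theorem conj_fourierChar (x : ℝ) : conj (𝐞 x : ℂ) = 𝐞 (-x) := by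
  rw [AddChar.map_neg_eq_inv, Circle.coe_inv_eq_conj]

theorem conj_fourier (f : V → ℂ) (w : V) :
    conj (𝓕 f w) = 𝓕⁻ (fun v => conj (f v)) w := by
  rw [Real.fourier_eq, Real.fourierInv_eq, ← integral_conj]
  simp only [Circle.smul_def, smul_eq_mul, map_mul, conj_fourierChar, neg_neg]

theorem conj_fourier_ofReal (q : V → ℝ) (w : V) :
    conj (𝓕 (fun v => (q v : ℂ)) w) = 𝓕 (fun v => (q v : ℂ)) (-w) := by
  simp only [conj_fourier, Complex.conj_ofReal, Real.fourierInv_eq_fourier_neg]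

theorem fourier_ofReal_even {q : V → ℝ} (hq : Function.Even q) (w : V) :
    ((𝓕 (fun v => (q v : ℂ)) w).re : ℂ) = 𝓕 (fun v => (q v : ℂ)) w := by
  refine Complex.conj_eq_iff_re.1 ?_
  simp only [conj_fourier, Complex.conj_ofReal, Real.fourierInv_eq_fourier_comp_neg, hq _]

theorem re_fourier_ofReal_odd {q : V → ℝ} (hq : Function.Odd q) (w : V) :
    (𝓕 (fun v => (q v : ℂ)) w).re = 0 := by
  have hconj : conj (𝓕 (fun v => (q v : ℂ)) w) = -𝓕 (fun v => (q v : ℂ)) w := by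
    simp only [conj_fourier, Complex.conj_ofReal, Real.fourierInv_eq_fourier_comp_neg, hq _,
      Complex.ofReal_neg]
    simp only [Real.fourier_eq, smul_neg, integral_neg]
  have hre := congrArg Complex.re hconj
  rw [Complex.conj_re, Complex.neg_re] at hre
  linarith

theorem im_fourier_ofReal {q : V → ℝ} (hq : Integrable q) (w : V) :
    (𝓕 (fun v => (q v : ℂ)) w).im = -∫ v, q v * Real.sin (2 * Real.pi * ⟪v, w⟫_ℝ) := by
  rw [Real.fourier_eq, ← RCLike.im_eq_complex_im, ← integral_im, ← integral_neg]
  · congr with v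
    rw [Circle.smul_def, smul_eq_mul, Real.fourierChar_apply, RCLike.im_eq_complex_im,
      Complex.im_mul_ofReal, Complex.exp_ofReal_mul_I_im, mul_neg, Real.sin_neg]
    ring
  · exact (Real.fourierIntegral_convergent_iff w).2 hq.ofReal

end Fourier

section ExpSum

variable {V : Type*} [NormedAddCommGroup V] [InnerProductSpace ℝ V]

/-- The exponential sum `∑ₜ c t * exp (2πi⟪ω, t⟫)`, i.e. the inverse Fourier transform of the
finitely supported measure `∑ₜ c t • δₜ`. -/
noncomputable def expSum (c : V →₀ ℝ) (ω : V) : ℂ := c.sum fun t a => (a : ℂ) * 𝐞 ⟪ω, t⟫_ℝ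

theorem continuous_expSum (c : V →₀ ℝ) : Continuous (expSum c) :=
  continuous_finsetSum _ fun t _ => by
    have := Real.continuous_fourierChar
    fun_prop

theorem norm_expSum_le (c : V →₀ ℝ) (ω : V) : ‖expSum c ω‖ ≤ c.sum fun _ a => |a| := by
  refine (norm_sum_le _ _).trans_eq (Finset.sum_congr rfl fun t _ => ?_)
  rw [norm_mul, Circle.norm_coe, mul_one, Complex.norm_real, Real.norm_eq_abs]

theorem norm_expSum_sq (c : V →₀ ℝ) (ω : V) :
    ((‖expSum c ω‖ ^ 2 : ℝ) : ℂ) =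
      c.sum fun s a => c.sum fun t b => (a : ℂ) * (b * 𝐞 ⟪ω, t - s⟫_ℝ) := by
  rw [Complex.ofReal_pow, ← Complex.conj_mul']
  simp only [expSum, Finsupp.sum, map_sum, map_mul, Complex.conj_ofReal, conj_fourierChar,
    Finset.sum_mul_sum]
  refine Finset.sum_congr rfl fun s _ => Finset.sum_congr rfl fun t _ => ?_
  rw [inner_sub_right, sub_eq_neg_add, AddChar.map_add_eq_mul, Circle.coe_mul]
  ring

variable [MeasurableSpace V] [BorelSpace V] [FiniteDimensional ℝ V]

theorem integrable_fourierChar_inner_mul {u : V → ℂ} (hu : Integrable u) (t : V) :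
    Integrable fun ω => (𝐞 ⟪ω, t⟫_ℝ : ℂ) * u ω :=
  hu.bdd_mul (c := 1) (by have := Real.continuous_fourierChar; fun_prop)
    (ae_of_all _ fun ω => (Circle.norm_coe _).le)

theorem sum_mul_fourierInv {u : V → ℂ} (hu : Integrable u) (c : V →₀ ℝ) :
    (c.sum fun t a => (a : ℂ) * 𝓕⁻ u t) = ∫ ω, expSum c ω * u ω := by
  simp only [expSum, Finsupp.sum, Finset.sum_mul, Real.fourierInv_eq, Circle.smul_def, smul_eq_mul,
    mul_assoc]
  rw [integral_finsetSum _ fun t _ => (integrable_fourierChar_inner_mul hu t).const_mul _]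
  simp only [integral_const_mul]

theorem integrable_norm_expSum_sq_mul {q : V → ℝ} (hq : Integrable q) (c : V →₀ ℝ) :
    Integrable fun ω => ‖expSum c ω‖ ^ 2 * q ω := by
  refine hq.bdd_mul (c := (c.sum fun _ a => |a|) ^ 2)
    ((continuous_expSum c).norm.pow 2).aestronglyMeasurable (ae_of_all _ fun ω => ?_)
  rw [norm_pow, norm_norm]
  exact pow_le_pow_left₀ (norm_nonneg _) (norm_expSum_le c ω) 2

theorem sum_mul_fourier_sub_mul {u : V → ℂ} (hu : Integrable u) (c : V →₀ ℝ) :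
    (c.sum fun s a => c.sum fun t b => (a : ℂ) * 𝓕 u (s - t) * b) =
      ∫ ω, (‖expSum c ω‖ ^ 2 : ℝ) * u ω := by
  have hint (s t : V) : Integrable fun ω => (c s : ℂ) * (c t * (𝐞 ⟪ω, t - s⟫_ℝ * u ω)) :=
    ((integrable_fourierChar_inner_mul hu (t - s)).const_mul _).const_mul _
  have hfourier (s t : V) : 𝓕 u (s - t) = ∫ ω, (𝐞 ⟪ω, t - s⟫_ℝ : ℂ) * u ω := by
    rw [← neg_sub, ← Real.fourierInv_eq_fourier_neg, Real.fourierInv_eq]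
    simp only [Circle.smul_def, smul_eq_mul]
  simp only [norm_expSum_sq, Finsupp.sum, Finset.sum_mul, mul_assoc, hfourier]
  rw [integral_finsetSum _ fun s _ => integrable_finsetSum _ fun t _ => hint s t]
  refine Finset.sum_congr rfl fun s _ => ?_
  rw [integral_finsetSum _ fun t _ => hint s t]
  refine Finset.sum_congr rfl fun t _ => ?_
  rw [integral_const_mul, integral_const_mul, mul_comm (c t : ℂ)]

theorem sum_mul_re_fourier_sub_mul {q : V → ℝ} (hq : Integrable q) (c : V →₀ ℝ) :
    (c.sum fun s a => c.sum fun t b => a * (𝓕 (fun ω => (q ω : ℂ)) (s - t)).re * b) =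
      ∫ ω, ‖expSum c ω‖ ^ 2 * q ω := by
  have h := congrArg Complex.re
    (sum_mul_fourier_sub_mul (u := fun ω => (q ω : ℂ)) hq.ofReal c)
  simp only [← Complex.ofReal_mul, integral_complex_ofReal, Complex.ofReal_re] at h
  simpa only [Finsupp.sum, Complex.re_sum, Complex.re_mul_ofReal, Complex.re_ofReal_mul] using h

end ExpSum

section Kernel

variable {Q : ℝ → ℝ}

theorem ofReal_spectralKernel (hQ : Function.Even Q) (s t : ℝ) :
    (spectralKernel Q s t : ℂ) = 𝓕 (fun ω : ℝ => (Q ω : ℂ)) (s - t) :=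
  fourier_ofReal_even hQ (s - t)

theorem spectralKernel_comm (Q : ℝ → ℝ) (s t : ℝ) :
    spectralKernel Q s t = spectralKernel Q t s := by
  rw [spectralKernel, spectralKernel, ← neg_sub, ← conj_fourier_ofReal, Complex.conj_re]

theorem spectralKernel_add_add (Q : ℝ → ℝ) (s t h : ℝ) :
    spectralKernel Q (s + h) (t + h) = spectralKernel Q s t := by
  rw [spectralKernel, spectralKernel, add_sub_add_right_eq_sub]

theorem spectralKernel_le (Q : ℝ → ℝ) (s t : ℝ) : spectralKernel Q s t ≤ ∫ ω, |Q ω| := by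
  refine (Complex.re_le_norm _).trans ((norm_fourier_le _ _).trans_eq ?_)
  simp only [Complex.norm_real, Real.norm_eq_abs]

theorem continuous_spectralKernel (hQ : Integrable Q) :
    Continuous (Function.uncurry (spectralKernel Q)) :=
  Complex.continuous_re.comp
    ((continuous_fourier_of_integrable hQ.ofReal).comp (continuous_fst.sub continuous_snd))

theorem sum_mul_spectralKernel_mul (hQ : Integrable Q) (c : ℝ →₀ ℝ) :
    (c.sum fun s a => c.sum fun t b => a * spectralKernel Q s t * b) =
      ∫ ω, ‖expSum c ω‖ ^ 2 * Q ω :=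
  sum_mul_re_fourier_sub_mul hQ c

theorem posSemidef_spectralKernel (hQ : Integrable Q) (hQ_nonneg : 0 ≤ᵐ[volume] Q) :
    (Matrix.of (spectralKernel Q)).PosSemidef := by
  refine ⟨Matrix.ext fun s t => spectralKernel_comm Q t s, fun c => ?_⟩
  simp only [Matrix.of_apply, star_trivial]
  rw [sum_mul_spectralKernel_mul hQ]
  refine integral_nonneg_of_ae ?_
  filter_upwards [hQ_nonneg] with ω hω using mul_nonneg (sq_nonneg _) hω

end Kernel

section RKHS

variable {X H : Type*} [NormedAddCommGroup H] [InnerProductSpace ℝ H] [CompleteSpace H]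
  [RKHS ℝ H X ℝ] {k : X → X → ℝ}

variable (H) in
/-- The combination `∑ₓ c x • k(·, x)` of sections of the reproducing kernel of `H`. -/
noncomputable def kerSum : (X →₀ ℝ) →ₗ[ℝ] H :=
  Finsupp.linearCombination ℝ fun x => RKHS.kerFun H x (1 : ℝ)

theorem kerSum_single (x : X) : kerSum H (Finsupp.single x 1) = RKHS.kerFun H x (1 : ℝ) := by
  rw [kerSum, Finsupp.linearCombination_single, one_smul]

theorem inner_kerSum_single (F : H) (x : X) : ⟪F, kerSum H (Finsupp.single x 1)⟫_ℝ = F x := by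
  rw [kerSum_single, RKHS.inner_kerFun, Real.inner_apply, mul_one]

theorem denseRange_kerSum : DenseRange (kerSum H : (X →₀ ℝ) → H) := by
  have hspan : Submodule.span ℝ {RKHS.kerFun H x v | (x : X) (v : ℝ)} ≤ (kerSum H).range := by
    refine Submodule.span_le.2 ?_
    rintro _ ⟨x, v, rfl⟩
    refine ⟨Finsupp.single x v, ?_⟩
    rw [kerSum, Finsupp.linearCombination_single, ← map_smul, smul_eq_mul, mul_one]
  rw [DenseRange, ← LinearMap.coe_range, Submodule.dense_iff_topologicalClosure_eq_top, eq_top_iff,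
    ← RKHS.kerFun_dense]
  exact Submodule.topologicalClosure_mono hspan

theorem HasKernel.norm_kerSum_sq (hk : HasKernel H k) (c : X →₀ ℝ) :
    ‖kerSum H c‖ ^ 2 = c.sum fun x a => c.sum fun y b => a * k x y * b := by
  rw [← real_inner_self_eq_norm_sq, kerSum, Finsupp.linearCombination_apply]
  simp only [Finsupp.sum, sum_inner, inner_sum]
  rw [Finset.sum_comm]
  refine Finset.sum_congr rfl fun x _ => Finset.sum_congr rfl fun y _ => ?_
  rw [real_inner_smul_left, real_inner_smul_right, RKHS.kerFun_inner, RKHS.kerFun_apply, hk,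
    Real.inner_apply]
  ring

/-- The hypothesis bounds the functional `∑ₓ c x • k(·, x) ↦ ∑ₓ c x * f x`, whose Riesz
representative is `f`. -/
theorem HasKernel.exists_norm_sq_le (hk : HasKernel H k) {f : X → ℝ} {N : ℝ} (hN : 0 ≤ N)
    (hf : ∀ c : X →₀ ℝ, (c.sum fun x a => a * f x) ^ 2 ≤
      N * c.sum fun x a => c.sum fun y b => a * k x y * b) :
    ∃ F : H, (∀ x, F x = f x) ∧ ‖F‖ ^ 2 ≤ N := by
  let φ : (X →₀ ℝ) →ₗ[ℝ] ℝ := Finsupp.linearCombination ℝ f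
  have hφ (c : X →₀ ℝ) : ‖φ c‖ ≤ √N * ‖kerSum H c‖ := by
    refine abs_le_of_sq_le_sq ?_ (by positivity)
    rw [mul_pow, Real.sq_sqrt hN, hk.norm_kerSum_sq]
    simpa only [φ, Finsupp.linearCombination_apply, smul_eq_mul] using hf c
  let ℓ : StrongDual ℝ H := φ.extendOfNorm (kerSum H)
  refine ⟨(InnerProductSpace.toDual ℝ H).symm ℓ, fun x => ?_, ?_⟩
  · rw [← inner_kerSum_single, InnerProductSpace.toDual_symm_apply,
      LinearMap.extendOfNorm_eq denseRange_kerSum ⟨_, hφ⟩, Finsupp.linearCombination_single,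
      one_smul]
  · rw [LinearIsometryEquiv.norm_map, ← Real.sq_sqrt hN]
    gcongr
    exact LinearMap.opNorm_extendOfNorm_le denseRange_kerSum (Real.sqrt_nonneg N) hφ

end RKHS

section WeightedCauchySchwarz

variable {α : Type*} [MeasurableSpace α] {μ : Measure α}

theorem sq_integral_mul_norm_le {E F : Type*} [NormedAddCommGroup E] [NormedAddCommGroup F]
    {f : α → E} {g : α → F} (hf : MemLp f 2 μ) (hg : MemLp g 2 μ) :
    (∫ x, ‖f x‖ * ‖g x‖ ∂μ) ^ 2 ≤ (∫ x, ‖f x‖ ^ 2 ∂μ) * ∫ x, ‖g x‖ ^ 2 ∂μ := by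
  have holder := integral_mul_le_Lp_mul_Lq_of_nonneg Real.HolderConjugate.two_two
    (ae_of_all μ fun x => norm_nonneg (f x)) (ae_of_all μ fun x => norm_nonneg (g x))
    (by simpa using hf.norm) (by simpa using hg.norm)
  simp only [← Real.sqrt_eq_rpow, Real.rpow_two] at holder
  calc (∫ x, ‖f x‖ * ‖g x‖ ∂μ) ^ 2
      ≤ (√(∫ x, ‖f x‖ ^ 2 ∂μ) * √(∫ x, ‖g x‖ ^ 2 ∂μ)) ^ 2 :=
        pow_le_pow_left₀ (integral_nonneg fun x => by positivity) holder 2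
    _ = (∫ x, ‖f x‖ ^ 2 ∂μ) * ∫ x, ‖g x‖ ^ 2 ∂μ := by
        rw [mul_pow, Real.sq_sqrt (integral_nonneg fun x => by positivity),
          Real.sq_sqrt (integral_nonneg fun x => by positivity)]

theorem sq_norm_integral_mul_le {f g : α → ℂ} {q : α → ℝ} (hq : AEMeasurable q μ)
    (hq_pos : ∀ᵐ x ∂μ, 0 < q x) (hf : AEStronglyMeasurable f μ) (hg : AEStronglyMeasurable g μ)
    (hfq : Integrable (fun x => ‖f x‖ ^ 2 * q x) μ)
    (hgq : Integrable (fun x => ‖g x‖ ^ 2 / q x) μ) :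
    ‖∫ x, f x * g x ∂μ‖ ^ 2 ≤ (∫ x, ‖f x‖ ^ 2 * q x ∂μ) * ∫ x, ‖g x‖ ^ 2 / q x ∂μ := by
  have hF : (fun x => ‖‖f x‖ * √(q x)‖ ^ 2) =ᵐ[μ] fun x => ‖f x‖ ^ 2 * q x := by
    filter_upwards [hq_pos] with x hx
    rw [Real.norm_eq_abs, sq_abs, mul_pow, Real.sq_sqrt hx.le]
  have hG : (fun x => ‖‖g x‖ / √(q x)‖ ^ 2) =ᵐ[μ] fun x => ‖g x‖ ^ 2 / q x := by
    filter_upwards [hq_pos] with x hx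
    rw [Real.norm_eq_abs, sq_abs, div_pow, Real.sq_sqrt hx.le]
  have hFG : (fun x => ‖‖f x‖ * √(q x)‖ * ‖‖g x‖ / √(q x)‖) =ᵐ[μ] fun x => ‖f x * g x‖ := by
    filter_upwards [hq_pos] with x hx
    have := Real.sqrt_pos.2 hx
    rw [← norm_mul, ← mul_div_assoc, mul_right_comm, mul_div_cancel_right₀ _ this.ne', ← norm_mul,
      norm_norm]
  have hF2 : MemLp (fun x => ‖f x‖ * √(q x)) 2 μ :=
    (memLp_two_iff_integrable_sq_norm (hf.norm.mul hq.sqrt.aestronglyMeasurable)).2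
      (hfq.congr hF.symm)
  have hG2 : MemLp (fun x => ‖g x‖ / √(q x)) 2 μ :=
    (memLp_two_iff_integrable_sq_norm
      (hg.norm.aemeasurable.div hq.sqrt).aestronglyMeasurable).2 (hgq.congr hG.symm)
  calc ‖∫ x, f x * g x ∂μ‖ ^ 2 ≤ (∫ x, ‖f x * g x‖ ∂μ) ^ 2 := by
        gcongr
        exact norm_integral_le_integral_norm _
    _ ≤ (∫ x, ‖f x‖ ^ 2 * q x ∂μ) * ∫ x, ‖g x‖ ^ 2 / q x ∂μ := by
        rw [← integral_congr_ae hF, ← integral_congr_ae hG, ← integral_congr_ae hFG]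
        exact sq_integral_mul_norm_le hF2 hG2

end WeightedCauchySchwarz

section RKHSFourier

variable {V H : Type*} [NormedAddCommGroup V] [InnerProductSpace ℝ V] [MeasurableSpace V]
  [BorelSpace V] [FiniteDimensional ℝ V] [NormedAddCommGroup H] [InnerProductSpace ℝ H]
  [CompleteSpace H] [RKHS ℝ H V ℝ]

theorem HasKernel.exists_norm_sq_le_of_fourierInv {q : V → ℝ} (hq : Integrable q)
    (hq_pos : ∀ᵐ ω, 0 < q ω)
    (hk : HasKernel H fun s t => (𝓕 (fun ω => (q ω : ℂ)) (s - t)).re) {f : V → ℝ} {u : V → ℂ}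
    (hu : Integrable u) (hf : ∀ t, (f t : ℂ) = 𝓕⁻ u t)
    (huq : Integrable fun ω => ‖u ω‖ ^ 2 / q ω) :
    ∃ F : H, (∀ t, F t = f t) ∧ ‖F‖ ^ 2 ≤ ∫ ω, ‖u ω‖ ^ 2 / q ω := by
  refine hk.exists_norm_sq_le (integral_nonneg_of_ae ?_) fun c => ?_
  · filter_upwards [hq_pos] with ω hω using div_nonneg (sq_nonneg _) hω.le
  · have hfc : ((c.sum fun t a => a * f t : ℝ) : ℂ) = ∫ ω, expSum c ω * u ω := by
      simp only [← sum_mul_fourierInv hu, ← hf, Finsupp.sum, Complex.ofReal_sum, Complex.ofReal_mul]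
    rw [sum_mul_re_fourier_sub_mul hq, mul_comm, ← sq_abs, ← Real.norm_eq_abs,
      ← Complex.norm_real, hfc]
    exact sq_norm_integral_mul_le hq.aemeasurable hq_pos
      (continuous_expSum c).aestronglyMeasurable hu.aestronglyMeasurable
      (integrable_norm_expSum_sq_mul hq c) huq

end RKHSFourier

section Universality

theorem topologicalClosure_eq_top_of_forall_dual {𝕜 E : Type*} [RCLike 𝕜] [NormedAddCommGroup E]
    [NormedSpace 𝕜 E] {S : Submodule 𝕜 E}
    (hS : ∀ Λ : StrongDual 𝕜 E, (∀ v ∈ S, Λ v = 0) → Λ = 0) : S.topologicalClosure = ⊤ := by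
  refine S.topologicalClosure.eq_top_iff'.2 fun v => by_contra fun hv => ?_
  have : IsClosed (S.topologicalClosure : Set E) := S.isClosed_topologicalClosure
  obtain ⟨g, hg⟩ := SeparatingDual.exists_ne_zero (R := 𝕜) (V := E ⧸ S.topologicalClosure)
    (x := S.topologicalClosure.mkQ v) (by simpa using hv)
  have hzero := hS (g.comp S.topologicalClosure.mkQL) fun w hw => by
    have : S.topologicalClosure.mkQ w = 0 := by simpa using S.le_topologicalClosure hw
    simpa using congrArg g this
  exact hg (DFunLike.congr_fun hzero v)

variable {V : Type*} [NormedAddCommGroup V] [InnerProductSpace ℝ V]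

/-- The character `x ↦ exp (2πi⟪ω, x⟫)` restricted to `K`. -/
noncomputable def charOn (K : Set V) (ω : V) : C(K, ℂ) where
  toFun x := 𝐞 ⟪ω, x⟫_ℝ
  continuous_toFun := by have := Real.continuous_fourierChar; fun_prop

theorem charOn_apply (K : Set V) (ω : V) (x : K) : charOn K ω x = 𝐞 ⟪ω, (x : V)⟫_ℝ := rfl

theorem continuous_charOn (K : Set V) : Continuous (charOn K) :=
  ContinuousMap.continuous_of_continuous_uncurry _ (by
    have := Real.continuous_fourierChar
    simp only [Function.uncurry_def, charOn_apply]
    fun_prop)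

variable {K : Set V} [CompactSpace K]

theorem norm_charOn_le (ω : V) : ‖charOn K ω‖ ≤ 1 :=
  (ContinuousMap.norm_le _ zero_le_one).2 fun _ => (Circle.norm_coe _).le

theorem topologicalClosure_span_charOn :
    (Submodule.span ℂ (range (charOn K))).topologicalClosure = ⊤ := by
  let restrict : C(V, ℂ) →⋆ₐ[ℂ] C(K, ℂ) :=
    ContinuousMap.compStarAlgHom' ℂ ℂ ⟨Subtype.val, continuous_subtype_val⟩
  let A : StarSubalgebra ℂ C(K, ℂ) :=
    ((BoundedContinuousFunction.charPoly Real.continuous_fourierChar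
      (L := innerₗ V) continuous_inner).map
        (BoundedContinuousFunction.toContinuousMapStarₐ ℂ)).map restrict
  have hsep : A.SeparatesPoints := by
    intro x y hxy
    have hchar := BoundedContinuousFunction.separatesPoints_charPoly Real.continuous_fourierChar
      Real.fourierChar_ne_one (L := innerₗ V) continuous_inner fun v hv h =>
        hv (inner_self_eq_zero.1 (DFunLike.congr_fun h v))
    obtain ⟨_, ⟨f, hf, rfl⟩, hfxy⟩ := hchar (Subtype.coe_injective.ne hxy)
    exact ⟨_, ⟨restrict f, ⟨f, hf, rfl⟩, rfl⟩, hfxy⟩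
  have hA : A.topologicalClosure = ⊤ :=
    ContinuousMap.starSubalgebra_topologicalClosure_eq_top_of_separatesPoints A hsep
  have hle : (A : Set C(K, ℂ)) ⊆ Submodule.span ℂ (range (charOn K)) := by
    rintro _ ⟨_, ⟨f, hf, rfl⟩, rfl⟩
    obtain ⟨w, hw⟩ := (BoundedContinuousFunction.mem_charPoly f).1 hf
    have hf_eq : restrict (f.toContinuousMapStarₐ ℂ) = w.coeff.sum fun ω a => a • charOn K ω := by
      ext x
      refine (congrFun hw x).trans ?_
      simp only [Finsupp.sum, ContinuousMap.coe_sum, Finset.sum_apply, ContinuousMap.smul_apply,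
        charOn_apply, smul_eq_mul, innerₗ_apply_apply, real_inner_comm]
    exact hf_eq ▸ Submodule.sum_mem _ fun ω _ =>
      Submodule.smul_mem _ _ (Submodule.subset_span ⟨ω, rfl⟩)
  refine eq_top_iff.2 fun f _ => closure_mono hle ?_
  have : f ∈ A.topologicalClosure := hA ▸ StarSubalgebra.mem_top
  exact this

variable [MeasurableSpace V] [BorelSpace V] [FiniteDimensional ℝ V]

theorem integrable_smul_charOn {u : V → ℂ} (hu : Integrable u) :
    Integrable fun ω => u ω • charOn K ω :=
  hu.smul_bdd 1 (continuous_charOn K).aestronglyMeasurable (ae_of_all _ norm_charOn_le)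

variable (K) in
/-- The restriction of `𝓕⁻ u` to the compact set `K`, as an integral of characters in `C(K, ℂ)`, so
that functionals on `C(K, ℂ)` commute with it. -/
noncomputable def fourierInvOn (u : V → ℂ) : C(K, ℂ) := ∫ ω, u ω • charOn K ω

theorem fourierInvOn_apply {u : V → ℂ} (hu : Integrable u) (x : K) :
    fourierInvOn K u x = 𝓕⁻ u x := by
  rw [fourierInvOn, ContinuousMap.integral_apply (integrable_smul_charOn hu), Real.fourierInv_eq]
  simp only [ContinuousMap.smul_apply, charOn_apply, Circle.smul_def, smul_eq_mul, mul_comm]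

theorem map_fourierInvOn {u : V → ℂ} (hu : Integrable u) (Λ : StrongDual ℂ C(K, ℂ)) :
    Λ (fourierInvOn K u) = ∫ ω, u ω * Λ (charOn K ω) := by
  rw [fourierInvOn, ← Λ.integral_comp_comm (integrable_smul_charOn hu)]
  simp only [map_smul, smul_eq_mul]

/-- Testing against the sections `k(·, z)` gives `𝓕 (q * c) = 0` on `K` for
`c ω = Λ (exp (2πi⟪ω, ·⟫))`; applying `Λ` to the conjugate of this identity gives
`∫ q * |c| ^ 2 = 0`. -/
theorem dual_eq_zero_of_map_section_eq_zero {q : V → ℝ} (hq : Integrable q)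
    (hq_pos : ∀ᵐ ω, 0 < q ω) {Λ : StrongDual ℂ C(K, ℂ)}
    (hΛ : ∀ z : K, Λ (fourierInvOn K fun ω => 𝐞 (-⟪ω, (z : V)⟫_ℝ) • (q ω : ℂ)) = 0) : Λ = 0 := by
  set c : V → ℂ := fun ω => Λ (charOn K ω)
  have hc : Continuous c := Λ.continuous.comp (continuous_charOn K)
  have hc_le (ω : V) : ‖c ω‖ ≤ ‖Λ‖ := Λ.unit_le_opNorm _ (norm_charOn_le ω)
  have hqℂ : Integrable fun ω => (q ω : ℂ) := hq.ofReal
  have hqc : Integrable fun ω => (q ω : ℂ) * conj (c ω) :=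
    hqℂ.mul_bdd (c := ‖Λ‖) (by fun_prop) (ae_of_all _ fun ω => by simpa using hc_le ω)
  have hfourier (z : K) : 𝓕 (fun ω => (q ω : ℂ) * c ω) z = 0 := by
    rw [← hΛ z, map_fourierInvOn ((Real.fourierIntegral_convergent_iff _).2 hqℂ),
      Real.fourier_eq]
    simp only [smul_mul_assoc, c]
  have hconj : fourierInvOn K (fun ω => (q ω : ℂ) * conj (c ω)) = 0 := by
    ext z
    rw [fourierInvOn_apply hqc, ContinuousMap.zero_apply, ← map_zero conj, ← hfourier z,
      conj_fourier]
    simp only [map_mul, Complex.conj_ofReal]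
  have henergy : ∫ ω, q ω * ‖c ω‖ ^ 2 = 0 := by
    have h := map_fourierInvOn hqc Λ
    simp only [hconj, map_zero, mul_assoc] at h
    simp only [c, Complex.conj_mul', ← Complex.ofReal_pow, ← Complex.ofReal_mul] at h
    rw [integral_complex_ofReal] at h
    exact_mod_cast h.symm
  have hc_ae : c =ᵐ[volume] 0 := by
    have hnonneg : 0 ≤ᵐ[volume] fun ω => q ω * ‖c ω‖ ^ 2 := by
      filter_upwards [hq_pos] with ω hω using mul_nonneg hω.le (sq_nonneg _)
    have hint : Integrable fun ω => q ω * ‖c ω‖ ^ 2 :=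
      hq.mul_bdd (c := ‖Λ‖ ^ 2) (by fun_prop) (ae_of_all _ fun ω => by
        simpa using pow_le_pow_left₀ (norm_nonneg _) (hc_le ω) 2)
    filter_upwards [hq_pos, (integral_eq_zero_iff_of_nonneg_ae hnonneg hint).1 henergy] with ω hω h
    simpa [hω.ne'] using h
  have hc_zero : c = 0 := (hc.ae_eq_iff_eq volume continuous_zero).1 hc_ae
  exact ContinuousLinearMap.ext_on
    (Submodule.dense_iff_topologicalClosure_eq_top.2 topologicalClosure_span_charOn) (by
      rintro _ ⟨ω, rfl⟩
      exact congrFun hc_zero ω)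

theorem exists_mem_span_eq_re {X : Type*} [TopologicalSpace X] {k : X → X → ℝ} {K : Set X}
    {κ : K → C(K, ℂ)} (hκ : ∀ z x : K, κ z x = k x z) {f : C(K, ℂ)}
    (hf : f ∈ Submodule.span ℂ (range κ)) :
    ∃ h ∈ Submodule.span ℝ ((fun (z : X) (x : X) => k x z) '' K), ∀ x : K, h x = (f x).re := by
  obtain ⟨c, rfl⟩ := Finsupp.mem_span_range_iff_exists_finsupp.1 hf
  refine ⟨∑ z ∈ c.support, (c z).re • fun x => k x z, Submodule.sum_mem _ fun z _ =>
    Submodule.smul_mem _ _ (Submodule.subset_span ⟨z, z.2, rfl⟩), fun x => ?_⟩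
  simp only [Finsupp.sum, Finset.sum_apply, ContinuousMap.coe_sum, Pi.smul_apply,
    ContinuousMap.smul_apply, hκ, smul_eq_mul, Complex.re_sum, Complex.re_mul_ofReal]

theorem isUniversalKernel_spectralKernel {Q : ℝ → ℝ} (hQ : Integrable Q)
    (hQ_even : Function.Even Q) (hQ_pos : ∀ᵐ ω, 0 < Q ω) :
    IsUniversalKernel (spectralKernel Q) := by
  refine ⟨continuous_spectralKernel hQ, fun K hK g hg ε hε => ?_⟩
  have : CompactSpace K := isCompact_iff_compactSpace.1 hK
  have hQℂ : Integrable fun ω => (Q ω : ℂ) := hQ.ofReal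
  let κ (z : K) : C(K, ℂ) := fourierInvOn K fun ω => 𝐞 (-⟪ω, (z : ℝ)⟫_ℝ) • (Q ω : ℂ)
  have hκ (z x : K) : κ z x = spectralKernel Q x z := by
    simp only [κ]
    rw [fourierInvOn_apply ((Real.fourierIntegral_convergent_iff _).2 hQℂ),
      spectralKernel_comm, ofReal_spectralKernel hQ_even, Real.fourierInv_eq, Real.fourier_eq]
    simp only [← mul_smul, ← AddChar.map_add_eq_mul, ← sub_eq_add_neg, inner_sub_right, neg_sub]
  have hdense : (Submodule.span ℂ (range κ)).topologicalClosure = ⊤ :=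
    topologicalClosure_eq_top_of_forall_dual fun Λ hΛ =>
      dual_eq_zero_of_map_section_eq_zero hQ hQ_pos fun z => hΛ _ (Submodule.subset_span ⟨z, rfl⟩)
  let gℂ : C(K, ℂ) := ⟨fun x => g x, Complex.continuous_ofReal.comp hg.domRestrict⟩
  obtain ⟨f, hf, hfg⟩ := Metric.mem_closure_iff.1
    (hdense ▸ Submodule.mem_top : gℂ ∈ (Submodule.span ℂ (range κ)).topologicalClosure) ε hε
  obtain ⟨h, hh, hhf⟩ := exists_mem_span_eq_re hκ hf
  refine ⟨h, hh, fun x hx => ?_⟩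
  calc |h x - g x| = |(f ⟨x, hx⟩ - gℂ ⟨x, hx⟩).re| := by rw [hhf ⟨x, hx⟩]; rfl
    _ ≤ dist (f ⟨x, hx⟩) (gℂ ⟨x, hx⟩) :=
        (Complex.abs_re_le_norm _).trans_eq (dist_eq_norm _ _).symm
    _ < ε := (ContinuousMap.dist_lt_iff hε).1 (dist_comm gℂ f ▸ hfg) ⟨x, hx⟩

end Universality

theorem integrable_of_memLp_top_of_hasCompactSupport {X E : Type*} [TopologicalSpace X]
    [MeasurableSpace X] [OpensMeasurableSpace X] [NormedAddCommGroup E] {μ : Measure X}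
    [IsFiniteMeasureOnCompacts μ] {g : X → E} (hg : MemLp g ∞ μ) (hc : HasCompactSupport g) :
    Integrable g μ := by
  have : IsFiniteMeasure (μ.restrict (tsupport g)) :=
    ⟨by simpa only [Measure.restrict_apply_univ] using hc.isCompact.measure_lt_top⟩
  exact (integrableOn_iff_integrable_of_support_subset (subset_tsupport g)).1
    (memLp_one_iff_integrable.1 ((hg.restrict _).mono_exponent le_top))

section IteratedDeriv

variable {E : Type*} [NormedAddCommGroup E] [NormedSpace ℝ E]

theorem support_iteratedDeriv_subset (n : ℕ) (f : ℝ → E) :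
    Function.support (iteratedDeriv n f) ⊆ tsupport f := fun t ht =>
  support_iteratedFDeriv_subset n <| by
    rwa [Function.mem_support, ← norm_ne_zero_iff, norm_iteratedFDeriv_eq_norm_iteratedDeriv,
      norm_ne_zero_iff]

theorem hasCompactSupport_iteratedDeriv {f : ℝ → E} (hf : HasCompactSupport f) (n : ℕ) :
    HasCompactSupport (iteratedDeriv n f) :=
  hf.mono' (support_iteratedDeriv_subset n f)

theorem eq_zero_of_eLpNorm_deriv_eq_zero {f : ℝ → E} (hf : Differentiable ℝ f)
    (hf' : Continuous (deriv f)) (hc : HasCompactSupport f)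
    (h : eLpNorm (deriv f) 1 volume = 0) : f = 0 := by
  rw [eLpNorm_eq_zero_iff hf'.aestronglyMeasurable one_ne_zero] at h
  have hderiv : deriv f = 0 := (hf'.ae_eq_iff_eq volume continuous_const).1 h
  obtain ⟨s, hs⟩ := (ne_univ_iff_exists_notMem _).1 hc.isCompact.ne_univ
  ext t
  rw [is_const_of_deriv_eq_zero hf (congrFun hderiv) t s, image_eq_zero_of_notMem_tsupport hs,
    Pi.zero_apply]

/-- The operator `f ↦ f + (-1)ᵐ f⁽²ᵐ⁾`, whose Fourier symbol is `1 + (2πx)²ᵐ`. -/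
noncomputable def pathOp (m : ℕ) (f : ℝ → E) (t : ℝ) : E :=
  f t + (-1 : ℝ) ^ m • iteratedDeriv (2 * m) f t

theorem support_pathOp_subset (m : ℕ) (f : ℝ → E) :
    Function.support (pathOp m f) ⊆ tsupport f :=
  (Function.support_add _ _).trans <| union_subset (subset_tsupport f) <|
    (Function.support_const_smul_subset _ _).trans (support_iteratedDeriv_subset _ f)

theorem iteratedDeriv_eq_smul_pathOp_sub (m : ℕ) (f : ℝ → E) :
    iteratedDeriv (2 * m) f = (-1 : ℝ) ^ m • (pathOp m f - f) := by
  ext t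
  rw [Pi.smul_apply, Pi.sub_apply, pathOp, add_sub_cancel_left, smul_smul, ← mul_pow, neg_one_mul,
    neg_neg, one_pow, one_smul]

/-- `f` is `n` times differentiable and `f, f', …, f⁽ⁿ⁾` are integrable; as in
`TimesDifferentiable`, the `n`-th derivative need not be continuous. -/
structure HasIntegrableDerivs (n : ℕ) (f : ℝ → E) : Prop where
  differentiable : ∀ j < n, Differentiable ℝ (iteratedDeriv j f)
  integrable : ∀ j ≤ n, Integrable (iteratedDeriv j f)

namespace HasIntegrableDerivs

variable {n : ℕ} {f : ℝ → E}

theorem mono {k : ℕ} (h : HasIntegrableDerivs n f) (hk : k ≤ n) : HasIntegrableDerivs k f :=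
  ⟨fun j hj => h.differentiable j (hj.trans_le hk), fun j hj => h.integrable j (hj.trans hk)⟩

theorem integrable_self (h : HasIntegrableDerivs n f) : Integrable f := by
  simpa only [iteratedDeriv_zero] using h.integrable 0 n.zero_le

theorem integrable_deriv (h : HasIntegrableDerivs n f) (hn : 1 ≤ n) : Integrable (deriv f) := by
  simpa only [iteratedDeriv_one] using h.integrable 1 hn

theorem integrable_pathOp {m : ℕ} (h : HasIntegrableDerivs (2 * m) f) : Integrable (pathOp m f) :=
  h.integrable_self.add ((h.integrable _ le_rfl).smul _)

theorem of_timesDifferentiable {f : ℝ → ℝ} (hd : TimesDifferentiable n f)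
    (hc : HasCompactSupport f) (hn : Integrable (iteratedDeriv n f)) : HasIntegrableDerivs n f := by
  refine ⟨hd, fun j hj => ?_⟩
  rcases hj.lt_or_eq with hj | rfl
  · exact (hd j hj).continuous.integrable_of_hasCompactSupport
      (hasCompactSupport_iteratedDeriv hc j)
  · exact hn

end HasIntegrableDerivs

end IteratedDeriv

section Bounded

variable {n m : ℕ} {f : ℝ → ℝ}

theorem measurable_iteratedDeriv (hn : n ≠ 0) (f : ℝ → ℝ) : Measurable (iteratedDeriv n f) := by
  obtain ⟨k, rfl⟩ := Nat.exists_eq_succ_of_ne_zero hn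
  rw [iteratedDeriv_succ]
  exact measurable_deriv _

theorem HasIntegrableDerivs.of_bounded (hn : n ≠ 0) (hd : TimesDifferentiable n f)
    (hc : HasCompactSupport f) {C : ℝ} (hC : ∀ t, |iteratedDeriv n f t| ≤ C) :
    HasIntegrableDerivs n f :=
  .of_timesDifferentiable hd hc <| integrable_of_memLp_top_of_hasCompactSupport
    (memLp_top_of_bound (measurable_iteratedDeriv hn f).aestronglyMeasurable C (ae_of_all _ hC))
    (hasCompactSupport_iteratedDeriv hc n)

theorem HasIntegrableDerivs.of_eLpNorm_pathOp_lt_top (hm : m ≠ 0)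
    (hd : TimesDifferentiable (2 * m) f) (hc : HasCompactSupport f)
    (hL : eLpNorm (pathOp m f) ∞ volume < ∞) : HasIntegrableDerivs (2 * m) f := by
  have hcont : Continuous f := (hd 0 (by omega)).continuous
  have hmeas : Measurable (pathOp m f) :=
    hcont.measurable.add
      ((measurable_iteratedDeriv (n := 2 * m) (by omega) f).const_smul ((-1 : ℝ) ^ m))
  have hint : Integrable (pathOp m f) := integrable_of_memLp_top_of_hasCompactSupport
    ⟨hmeas.aestronglyMeasurable, hL⟩ (hc.mono' (support_pathOp_subset m f))
  refine .of_timesDifferentiable hd hc ?_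
  rw [iteratedDeriv_eq_smul_pathOp_sub]
  exact (hint.sub (hcont.integrable_of_hasCompactSupport hc)).smul _

end Bounded

section Complexification

variable {n : ℕ} {f : ℝ → ℝ}

theorem support_ofReal_comp (f : ℝ → ℝ) :
    Function.support (fun t => (f t : ℂ)) = Function.support f :=
  Function.support_comp_eq _ Complex.ofReal_eq_zero f

theorem eLpNorm_ofReal_comp (f : ℝ → ℝ) (p : ℝ≥0∞) :
    eLpNorm (fun t => (f t : ℂ)) p volume = eLpNorm f p volume :=
  eLpNorm_congr_norm_ae (ae_of_all _ fun t => Complex.norm_real (f t))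

theorem deriv_ofReal_comp (hf : Differentiable ℝ f) :
    deriv (fun t : ℝ => (f t : ℂ)) = fun t => ((deriv f t : ℝ) : ℂ) :=
  funext fun t => (hf t).hasDerivAt.ofReal_comp.deriv

theorem TimesDifferentiable.iteratedDeriv_ofReal_comp (hf : TimesDifferentiable n f) {j : ℕ}
    (hj : j ≤ n) :
    iteratedDeriv j (fun t : ℝ => (f t : ℂ)) = fun t => ((iteratedDeriv j f t : ℝ) : ℂ) := by
  induction j with
  | zero => simp only [iteratedDeriv_zero]
  | succ j ih =>
    rw [iteratedDeriv_succ, ih (by omega), iteratedDeriv_succ, deriv_ofReal_comp (hf j hj)]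

theorem TimesDifferentiable.pathOp_ofReal_comp {m : ℕ} (hf : TimesDifferentiable (2 * m) f) :
    pathOp m (fun t : ℝ => (f t : ℂ)) = fun t => ((pathOp m f t : ℝ) : ℂ) := by
  ext t
  simp only [pathOp, hf.iteratedDeriv_ofReal_comp le_rfl, smul_eq_mul, Complex.ofReal_add,
    Complex.ofReal_mul, Complex.real_smul]

theorem HasIntegrableDerivs.ofReal_comp (hf : HasIntegrableDerivs n f) :
    HasIntegrableDerivs n fun t : ℝ => (f t : ℂ) := by
  have hd : TimesDifferentiable n f := hf.differentiable
  refine ⟨fun j hj t => ?_, fun j hj => ?_⟩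
  · rw [hd.iteratedDeriv_ofReal_comp hj.le]
    exact (hd j hj t).hasDerivAt.ofReal_comp.differentiableAt
  · rw [hd.iteratedDeriv_ofReal_comp hj]
    exact (hf.integrable j hj).ofReal

end Complexification

section FourierDeriv

variable {E : Type*} [NormedAddCommGroup E] [NormedSpace ℂ E] {n m : ℕ} {f : ℝ → E}

namespace HasIntegrableDerivs

theorem fourier_iteratedDeriv (h : HasIntegrableDerivs n f) {j : ℕ} (hj : j ≤ n) (x : ℝ) :
    𝓕 (iteratedDeriv j f) x = (2 * Real.pi * I * x) ^ j • 𝓕 f x := by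
  induction j with
  | zero => rw [iteratedDeriv_zero, pow_zero, one_smul]
  | succ j ih =>
    have hint := h.integrable (j + 1) hj
    rw [iteratedDeriv_succ] at hint ⊢
    simp only [Real.fourier_deriv (h.integrable j (by omega)) (h.differentiable j hj) hint,
      ih (by omega), smul_smul, pow_succ']

theorem fourier_deriv (h : HasIntegrableDerivs n f) (hn : 1 ≤ n) (x : ℝ) :
    𝓕 (deriv f) x = (2 * Real.pi * I * x) • 𝓕 f x := by
  simpa only [iteratedDeriv_one, pow_one] using h.fourier_iteratedDeriv hn x

theorem fourier_pathOp (h : HasIntegrableDerivs (2 * m) f) (x : ℝ) :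
    𝓕 (pathOp m f) x = (1 + (2 * Real.pi * x) ^ (2 * m)) • 𝓕 f x := by
  have hlin : 𝓕 (pathOp m f) x = 𝓕 f x + (-1 : ℝ) ^ m • 𝓕 (iteratedDeriv (2 * m) f) x := by
    have htop := (Real.fourierIntegral_convergent_iff x).2 (h.integrable _ le_rfl)
    simp only [Real.fourier_eq, pathOp, smul_add, smul_comm _ ((-1 : ℝ) ^ m)]
    exact (integral_add ((Real.fourierIntegral_convergent_iff x).2 h.integrable_self)
      (htop.smul ((-1 : ℝ) ^ m))).trans (congrArg _ (integral_smul _ _))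
  have hsymbol : ((-1 : ℝ) ^ m : ℂ) * (2 * Real.pi * I * x) ^ (2 * m) =
      ((2 * Real.pi * x) ^ (2 * m) : ℝ) := by
    push_cast
    rw [pow_mul, pow_mul, ← mul_pow]
    congr 1
    linear_combination (-(2 * Real.pi * x) ^ 2 : ℂ) * Complex.I_sq
  rw [hlin, h.fourier_iteratedDeriv le_rfl, ← Complex.coe_smul, smul_smul, Complex.ofReal_pow,
    hsymbol, Complex.coe_smul, add_smul, one_smul]

theorem integrable_fourier (h : HasIntegrableDerivs 2 f) : Integrable (𝓕 f) := by
  have hweight : Integrable fun x : ℝ => (1 + (2 * Real.pi * x) ^ 2)⁻¹ * ∫ t, ‖pathOp 1 f t‖ :=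
    (integrable_inv_one_add_sq.comp_mul_left' Real.two_pi_pos.ne').mul_const _
  refine hweight.mono' ?_ (ae_of_all _ fun x => ?_)
  · exact (continuous_fourier_of_integrable h.integrable_self).aestronglyMeasurable
  · have hx := norm_fourier_le (pathOp 1 f) x
    rw [h.fourier_pathOp (m := 1), mul_one, norm_smul, Real.norm_of_nonneg (by positivity)] at hx
    rwa [le_inv_mul_iff₀ (by positivity)]

theorem fourierInv_fourier [CompleteSpace E] (h : HasIntegrableDerivs 2 f) : 𝓕⁻ (𝓕 f) = f := by
  have hcont : Continuous f := by
    simpa only [iteratedDeriv_zero] using (h.differentiable 0 two_pos).continuous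
  exact hcont.fourierInv_fourier_eq h.integrable_self h.integrable_fourier

end HasIntegrableDerivs

end FourierDeriv

section Correlation

variable {V : Type*} [NormedAddCommGroup V] [InnerProductSpace ℝ V] [MeasurableSpace V]
  [BorelSpace V] [FiniteDimensional ℝ V] {g h : V → ℂ}

/-- The cross-correlation `u ↦ ∫ g s * conj (h (s - u)) ds`, whose Fourier transform is
`𝓕 g * conj (𝓕 h)`. -/
noncomputable def correlation (g h : V → ℂ) : V → ℂ :=
  g ⋆[ContinuousLinearMap.mul ℂ ℂ] fun s => conj (h (-s))

theorem correlation_apply (g h : V → ℂ) (u : V) :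
    correlation g h u = ∫ s, g s * conj (h (s - u)) := by
  simp only [correlation, convolution, ContinuousLinearMap.mul_apply', neg_sub]

theorem integrable_conj_comp_neg (hh : Integrable h) : Integrable fun s => conj (h (-s)) :=
  Complex.conjLIE.toContinuousLinearEquiv.toContinuousLinearMap.integrable_comp hh.comp_neg

theorem integrable_correlation (hg : Integrable g) (hh : Integrable h) :
    Integrable (correlation g h) :=
  hg.integrable_convolution _ (integrable_conj_comp_neg hh)

theorem fourier_correlation (hg : Integrable g) (hh : Integrable h) (w : V) :
    𝓕 (correlation g h) w = 𝓕 g w * conj (𝓕 h w) := by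
  rw [correlation, Real.fourier_mul_convolution_eq hg (integrable_conj_comp_neg hh), conj_fourier,
    Real.fourierInv_eq_fourier_comp_neg]

theorem enorm_correlation_le (hg : AEStronglyMeasurable g) (h : V → ℂ) (u : V) :
    ‖correlation g h u‖ₑ ≤ eLpNorm g 1 volume * eLpNorm h ∞ volume := by
  have hbound : ∀ᵐ s, ‖h (s - u)‖ₑ ≤ eLpNorm h ∞ volume := by
    rw [eLpNorm_exponent_top]
    exact (measurePreserving_sub_right volume u).quasiMeasurePreserving.ae
      (ae_le_eLpNormEssSup (f := h))
  rw [correlation_apply, eLpNorm_one_eq_lintegral_enorm, ← lintegral_mul_const'' _ hg.enorm]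
  refine (enorm_integral_le_lintegral_enorm _).trans (lintegral_mono_ae ?_)
  filter_upwards [hbound] with s hs
  rw [enorm_mul, RCLike.enorm_conj]
  gcongr

theorem correlation_eq_zero {K : Set V}
    (hK : ∀ s ∈ Function.support g, ∀ t ∈ Function.support h, s - t ∈ K) {u : V} (hu : u ∉ K) :
    correlation g h u = 0 := by
  rw [correlation_apply]
  refine integral_eq_zero_of_ae (ae_of_all _ fun s => ?_)
  by_contra hne
  obtain ⟨hgs, hhs⟩ := mul_ne_zero_iff.1 hne
  have := hK s hgs (s - u) (by simpa using hhs)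
  rw [sub_sub_cancel] at this
  exact hu this

/-- Parseval turns the integral into `∫ 𝓕 w * correlation g h`, and `correlation g h` is bounded by
`‖g‖₁ ‖h‖_∞` and vanishes outside `K`. -/
theorem enorm_integral_mul_fourier_mul_conj_fourier_le {w : V → ℂ} (hw : Integrable w)
    (hg : Integrable g) (hh : Integrable h) {K : Set V} (hKm : MeasurableSet K)
    (hK : ∀ s ∈ Function.support g, ∀ t ∈ Function.support h, s - t ∈ K) :
    ‖∫ x, w x * (𝓕 g x * conj (𝓕 h x))‖ₑ ≤
      eLpNorm (𝓕 w) 1 (volume.restrict K) * eLpNorm g 1 volume * eLpNorm h ∞ volume := by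
  simp only [← fourier_correlation hg hh]
  rw [← integral_fourier_mul hw (integrable_correlation hg hh), mul_assoc,
    eLpNorm_one_eq_lintegral_enorm, ← lintegral_mul_const'' _
      (continuous_fourier_of_integrable hw).enorm.measurable.aemeasurable,
    ← lintegral_indicator hKm]
  refine (enorm_integral_le_lintegral_enorm _).trans (lintegral_mono fun u => ?_)
  by_cases hu : u ∈ K
  · rw [indicator_of_mem hu, enorm_mul]
    gcongr
    exact enorm_correlation_le hg.aestronglyMeasurable h u
  · rw [correlation_eq_zero hK hu, mul_zero, enorm_zero]
    exact zero_le

end Correlation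

section Energy

variable {m : ℕ} {Q : ℝ → ℝ} {f : ℝ → ℂ}

/-- The energy `∫ |𝓕 f|² / Q`, which is the squared norm of `f` in the reproducing kernel Hilbert
space with spectral density `Q`. -/
noncomputable def spectralEnergy (Q : ℝ → ℝ) (f : ℝ → ℂ) : ℝ := ∫ x, ‖𝓕 f x‖ ^ 2 / Q x

/-- The symbol `2πix` of `d/dx` times the symbol `1 + (2πx)²ᵐ` of `pathOp` is `i / (R Q)`. -/
theorem HasIntegrableDerivs.norm_fourier_sq_div (hf : HasIntegrableDerivs (2 * m) f) (hm : 1 ≤ m)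
    {x : ℝ} (hx : x ≠ 0) (hQx : Q x ≠ 0) :
    ((‖𝓕 f x‖ ^ 2 / Q x : ℝ) : ℂ) = -I * (spectralWeight m Q x *
      (𝓕 (deriv f) x * conj (𝓕 (pathOp m f) x))) := by
  have hsymbol : 1 + (2 * Real.pi * x) ^ (2 * m) ≠ 0 := by
    have := (even_two_mul m).pow_nonneg (2 * Real.pi * x)
    positivity
  have hweight : ‖𝓕 f x‖ ^ 2 / Q x = spectralWeight m Q x *
      (2 * Real.pi * x * (1 + (2 * Real.pi * x) ^ (2 * m)) * ‖𝓕 f x‖ ^ 2) := by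
    rw [spectralWeight]
    field_simp
  rw [hf.fourier_deriv (by omega), hf.fourier_pathOp, hweight, smul_eq_mul, Complex.real_smul,
    map_mul, Complex.conj_ofReal]
  push_cast
  rw [← Complex.mul_conj']
  linear_combination (spectralWeight m Q x * (2 * Real.pi * x *
    (1 + (2 * Real.pi * x) ^ (2 * m)) * (𝓕 f x * conj (𝓕 f x))) : ℂ) * Complex.I_sq

theorem HasIntegrableDerivs.ae_norm_fourier_sq_div (hf : HasIntegrableDerivs (2 * m) f)
    (hm : 1 ≤ m) (hQ : ∀ᵐ x, Q x ≠ 0) :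
    (fun x => ((‖𝓕 f x‖ ^ 2 / Q x : ℝ) : ℂ)) =ᵐ[volume] fun x =>
      -I * (spectralWeight m Q x * (𝓕 (deriv f) x * conj (𝓕 (pathOp m f) x))) := by
  filter_upwards [hQ, Measure.ae_ne volume (0 : ℝ)] with x hQx hx
  exact hf.norm_fourier_sq_div hm hx hQx

theorem HasIntegrableDerivs.integrable_norm_fourier_sq_div (hf : HasIntegrableDerivs (2 * m) f)
    (hm : 1 ≤ m) (hQ : ∀ᵐ x, Q x ≠ 0) (hR : Integrable (spectralWeight m Q)) :
    Integrable fun x => ‖𝓕 f x‖ ^ 2 / Q x := by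
  have hf' := hf.integrable_deriv (by omega)
  have hcorr := integrable_correlation hf' hf.integrable_pathOp
  have hRℂ : Integrable fun x => (spectralWeight m Q x : ℂ) := hR.ofReal
  have hint : Integrable fun x => -I * (spectralWeight m Q x *
      (𝓕 (deriv f) x * conj (𝓕 (pathOp m f) x))) := by
    simp only [← fourier_correlation hf' hf.integrable_pathOp]
    exact (hRℂ.mul_bdd (continuous_fourier_of_integrable hcorr).aestronglyMeasurable
      (ae_of_all _ (norm_fourier_le _))).const_mul _
  exact (hint.congr (hf.ae_norm_fourier_sq_div hm hQ).symm).re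

theorem HasIntegrableDerivs.spectralEnergy_le (hf : HasIntegrableDerivs (2 * m) f) (hm : 1 ≤ m)
    (hQ : ∀ᵐ x, Q x ≠ 0) (hR : Integrable (spectralWeight m Q)) {T : ℝ}
    (hsupp : Function.support f ⊆ Icc 0 (T + 1)) :
    ENNReal.ofReal (spectralEnergy Q f) ≤ pathConst m Q T * eLpNorm (deriv f) 1 volume *
      eLpNorm (pathOp m f) ∞ volume := by
  have htsupp : tsupport f ⊆ Icc 0 (T + 1) := closure_minimal hsupp isClosed_Icc
  have hdiff : ∀ s ∈ Function.support (deriv f), ∀ t ∈ Function.support (pathOp m f),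
      s - t ∈ Icc (-T - 1) (T + 1) := fun s hs t ht => by
    have hs := htsupp (support_deriv_subset hs)
    have ht := htsupp (support_pathOp_subset m f ht)
    exact ⟨by linarith [hs.1, ht.2], by linarith [hs.2, ht.1]⟩
  calc ENNReal.ofReal (spectralEnergy Q f) ≤ ‖(spectralEnergy Q f : ℂ)‖ₑ := by
        rw [← ofReal_norm, Complex.norm_real]
        exact ENNReal.ofReal_le_ofReal (Real.le_norm_self _)
    _ = ‖∫ x, spectralWeight m Q x * (𝓕 (deriv f) x * conj (𝓕 (pathOp m f) x))‖ₑ := by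
        rw [spectralEnergy, ← integral_complex_ofReal,
          integral_congr_ae (hf.ae_norm_fourier_sq_div hm hQ), integral_const_mul, enorm_mul,
          enorm_neg, ← ofReal_norm I, Complex.norm_I, ENNReal.ofReal_one, one_mul]
    _ ≤ pathConst m Q T * eLpNorm (deriv f) 1 volume * eLpNorm (pathOp m f) ∞ volume :=
        enorm_integral_mul_fourier_mul_conj_fourier_le hR.ofReal (hf.integrable_deriv (by omega))
          hf.integrable_pathOp measurableSet_Icc hdiff

theorem HasIntegrableDerivs.eq_zero_of_spectralEnergy_nonpos (hf : HasIntegrableDerivs 2 f)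
    (hQ : ∀ᵐ x, 0 < Q x) (hfQ : Integrable fun x => ‖𝓕 f x‖ ^ 2 / Q x)
    (h : spectralEnergy Q f ≤ 0) : f = 0 := by
  have hnonneg : 0 ≤ᵐ[volume] fun x => ‖𝓕 f x‖ ^ 2 / Q x := by
    filter_upwards [hQ] with x hx using div_nonneg (sq_nonneg _) hx.le
  have hzero : 𝓕 f =ᵐ[volume] 0 := by
    filter_upwards [hQ, (integral_eq_zero_iff_of_nonneg_ae hnonneg hfQ).1
      (h.antisymm (integral_nonneg_of_ae hnonneg))] with x hx hfx
    simpa [hx.ne'] using hfx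
  ext t
  rw [← hf.fourierInv_fourier, Real.fourierInv_eq]
  refine integral_eq_zero_of_ae ?_
  filter_upwards [hzero] with x hx
  simp only [hx, Pi.zero_apply, smul_zero]

/-- Otherwise every test function supported in `[0, T + 1]` would have zero energy. -/
theorem pathConst_ne_zero (hm : 1 ≤ m) (hQ : ∀ᵐ x, 0 < Q x)
    (hR : Integrable (spectralWeight m Q)) {T : ℝ} (hT : 0 < T + 1) : pathConst m Q T ≠ 0 := by
  intro hzero
  let b : ContDiffBump ((T + 1) / 2) :=
    ⟨(T + 1) / 4, (T + 1) / 2, by linarith, by linarith⟩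
  have hsupp : Function.support (fun t => (b t : ℂ)) ⊆ Icc 0 (T + 1) := by
    rw [support_ofReal_comp, b.support_eq, Real.ball_eq_Ioo]
    exact Ioo_subset_Icc_self.trans (Icc_subset_Icc (sub_self _).ge (add_halves _).le)
  have hsmooth : ContDiff ℝ (2 * m : ℕ) b := b.contDiff
  have hb : HasIntegrableDerivs (2 * m) fun t => (b t : ℂ) :=
    (HasIntegrableDerivs.of_timesDifferentiable
      (fun j hj => hsmooth.differentiable_iteratedDeriv j (by exact_mod_cast hj))
      b.hasCompactSupport <|
        (hsmooth.continuous_iteratedDeriv _ le_rfl).integrable_of_hasCompactSupport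
          (hasCompactSupport_iteratedDeriv b.hasCompactSupport _)).ofReal_comp
  have hQ' : ∀ᵐ x, Q x ≠ 0 := hQ.mono fun _ hx => hx.ne'
  have henergy := hb.spectralEnergy_le hm hQ' hR hsupp
  rw [hzero, zero_mul, zero_mul, nonpos_iff_eq_zero, ENNReal.ofReal_eq_zero] at henergy
  have hb_zero := congrFun ((hb.mono (by omega)).eq_zero_of_spectralEnergy_nonpos hQ
    (hb.integrable_norm_fourier_sq_div hm hQ' hR) henergy) ((T + 1) / 2)
  rw [b.one_of_mem_closedBall (Metric.mem_closedBall_self b.rIn_pos.le)] at hb_zero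
  exact one_ne_zero hb_zero

end Energy

section RKHSNorm

variable {m : ℕ} {Q f : ℝ → ℝ} {H : Type*} [NormedAddCommGroup H] [InnerProductSpace ℝ H]
  [CompleteSpace H] [RKHS ℝ H ℝ ℝ]

theorem HasKernel.exists_norm_sq_le_spectralEnergy (hk : HasKernel H (spectralKernel Q))
    (hm : 1 ≤ m) (hQ : Integrable Q) (hQ_pos : ∀ᵐ x, 0 < Q x)
    (hR : Integrable (spectralWeight m Q)) (hf : HasIntegrableDerivs (2 * m) f) :
    ∃ F : H, (∀ t, F t = f t) ∧ ‖F‖ ^ 2 ≤ spectralEnergy Q fun t => (f t : ℂ) := by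
  have hf2 := hf.ofReal_comp.mono (k := 2) (by omega)
  exact hk.exists_norm_sq_le_of_fourierInv hQ hQ_pos hf2.integrable_fourier
    (fun t => (congrFun hf2.fourierInv_fourier t).symm)
    (hf.ofReal_comp.integrable_norm_fourier_sq_div hm (hQ_pos.mono fun _ hx => hx.ne') hR)

theorem HasKernel.ofReal_norm_sq_le (hk : HasKernel H (spectralKernel Q)) (hm : 1 ≤ m)
    (hQ : Integrable Q) (hQ_pos : ∀ᵐ x, 0 < Q x) (hR : Integrable (spectralWeight m Q)) {T : ℝ}
    (hT : 0 < T + 1) (hd : TimesDifferentiable (2 * m) f)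
    (hsupp : Function.support f ⊆ Icc 0 (T + 1)) {F : H} (hF : ∀ t, F t = f t) :
    ENNReal.ofReal (‖F‖ ^ 2) ≤ pathConst m Q T * eLpNorm (deriv f) 1 volume *
      eLpNorm (pathOp m f) ∞ volume := by
  have hc : HasCompactSupport f := HasCompactSupport.of_support_subset_isCompact isCompact_Icc hsupp
  have hf : Differentiable ℝ f := hd 0 (by omega)
  have hf' : Continuous (deriv f) := by
    simpa only [iteratedDeriv_one] using (hd 1 (by omega)).continuous
  by_cases hderiv : eLpNorm (deriv f) 1 volume = 0
  · have hF0 : F = 0 := RKHS.ext fun t => by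
      rw [hF, eq_zero_of_eLpNorm_deriv_eq_zero hf hf' hc hderiv, RKHS.coe_zero]
    rw [hF0, norm_zero, zero_pow two_ne_zero, ENNReal.ofReal_zero]
    exact zero_le
  by_cases hL : eLpNorm (pathOp m f) ∞ volume = ∞
  · rw [hL, ENNReal.mul_top (mul_ne_zero (pathConst_ne_zero hm hQ_pos hR hT) hderiv)]
    exact le_top
  have hfd : HasIntegrableDerivs (2 * m) f := .of_eLpNorm_pathOp_lt_top (by omega) hd hc
    (lt_top_iff_ne_top.2 hL)
  obtain ⟨F', hF', hnorm⟩ := hk.exists_norm_sq_le_spectralEnergy hm hQ hQ_pos hR hfd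
  obtain rfl : F = F' := RKHS.ext fun t => (hF t).trans (hF' t).symm
  have henergy := hfd.ofReal_comp.spectralEnergy_le hm (hQ_pos.mono fun _ hx => hx.ne') hR
    (by rwa [support_ofReal_comp])
  rw [hd.pathOp_ofReal_comp, deriv_ofReal_comp hf, eLpNorm_ofReal_comp, eLpNorm_ofReal_comp]
    at henergy
  exact (ENNReal.ofReal_le_ofReal hnorm).trans henergy

end RKHSNorm

section SineTransform

variable {g : ℝ → ℝ}

theorem intervalIntegrable_mul_sin {a b : ℝ} (hg : IntervalIntegrable g volume a b) :
    IntervalIntegrable (fun x => g x * Real.sin x) volume a b :=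
  hg.mul_continuousOn Real.continuous_sin.continuousOn

theorem intervalIntegral_mul_sin_nonneg (hg : IntervalIntegrable g volume 0 (2 * Real.pi))
    (ha : AntitoneOn g (Ioc 0 (2 * Real.pi))) :
    0 ≤ ∫ x in (0 : ℝ)..2 * Real.pi, g x * Real.sin x := by
  have hpi := Real.pi_pos
  have hmid : Real.pi ∈ Ioc 0 (2 * Real.pi) := ⟨hpi, by linarith⟩
  have hconst : ∫ x in (0 : ℝ)..2 * Real.pi, g Real.pi * Real.sin x = 0 := by
    rw [intervalIntegral.integral_const_mul, integral_sin, Real.cos_zero, Real.cos_two_pi,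
      sub_self, mul_zero]
  refine hconst.symm.trans_le <| intervalIntegral.integral_mono_on_of_le_Ioo (by positivity)
    (intervalIntegrable_mul_sin intervalIntegrable_const) (intervalIntegrable_mul_sin hg)
    fun x hx => ?_
  have hx' := Ioo_subset_Ioc_self hx
  rcases le_total x Real.pi with hle | hle
  · exact mul_le_mul_of_nonneg_right (ha hx' hmid hle)
      (Real.sin_nonneg_of_nonneg_of_le_pi hx.1.le hle)
  · refine mul_le_mul_of_nonpos_right (ha hmid hx' hle) ?_
    rw [← Real.sin_sub_two_pi]
    exact Real.sin_nonpos_of_nonpos_of_neg_pi_le (by linarith [hx.2]) (by linarith)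

theorem integral_Ioi_mul_sin_nonneg (hg : IntegrableOn g (Ioi 0)) (ha : AntitoneOn g (Ioi 0)) :
    0 ≤ ∫ x in Ioi 0, g x * Real.sin x := by
  let p (n : ℕ) : ℝ := n * (2 * Real.pi)
  have hp (n : ℕ) : 0 ≤ p n := by positivity
  have hp_succ (n : ℕ) : 2 * Real.pi + p n = p (n + 1) := by simp only [p]; push_cast; ring
  have hint {a b : ℝ} (ha : 0 ≤ a) (hb : 0 ≤ b) : IntervalIntegrable g volume a b :=
    intervalIntegrable_iff.2 (hg.mono_set fun x hx => (le_min ha hb).trans_lt hx.1)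
  have hperiod (n : ℕ) : 0 ≤ ∫ x in p n..p (n + 1), g x * Real.sin x := by
    have hshift := intervalIntegral.integral_comp_add_right (a := 0) (b := 2 * Real.pi)
      (fun x => g x * Real.sin x) (p n)
    simp only [p, Real.sin_add_nat_mul_two_pi] at hshift
    rw [← hp_succ, ← zero_add (p n), ← add_assoc, add_zero, ← hshift]
    refine intervalIntegral_mul_sin_nonneg ?_ fun x hx y hy hxy => ?_
    · simpa only [← hp_succ, sub_self, add_sub_cancel_right] using
        (hint (hp n) (hp (n + 1))).comp_add_right (p n)
    · exact ha (add_pos_of_pos_of_nonneg hx.1 (hp n)) (add_pos_of_pos_of_nonneg hy.1 (hp n))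
        (by gcongr)
  have hpartial (n : ℕ) : 0 ≤ ∫ x in (0 : ℝ)..p n, g x * Real.sin x := by
    have hsum := intervalIntegral.sum_integral_adjacent_intervals (a := p) (n := n) fun k _ =>
      intervalIntegrable_mul_sin (hint (hp k) (hp (k + 1)))
    rw [show p 0 = 0 by simp [p]] at hsum
    rw [← hsum]
    exact Finset.sum_nonneg fun k _ => hperiod k
  have hsin : IntegrableOn (fun x => g x * Real.sin x) (Ioi 0) :=
    hg.mul_bdd (c := 1) Real.continuous_sin.aestronglyMeasurable (ae_of_all _ Real.abs_sin_le_one)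
  exact ge_of_tendsto' (intervalIntegral_tendsto_integral_Ioi 0 hsin
    (tendsto_natCast_atTop_atTop.atTop_mul_const (by positivity))) hpartial

theorem integral_Ioi_mul_sin_mul_nonneg (hg : IntegrableOn g (Ioi 0))
    (ha : AntitoneOn g (Ioi 0)) {c : ℝ} (hc : 0 ≤ c) :
    0 ≤ ∫ x in Ioi 0, g x * Real.sin (c * x) := by
  obtain rfl | hc := hc.eq_or_lt
  · simp only [zero_mul, Real.sin_zero, mul_zero, integral_zero, le_refl]
  have hscale := integral_comp_mul_left_Ioi (fun x => g (c⁻¹ * x) * Real.sin x) 0 hc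
  simp only [inv_mul_cancel_left₀ hc.ne', mul_zero] at hscale
  rw [hscale, smul_eq_mul]
  refine mul_nonneg (inv_nonneg.2 hc.le) (integral_Ioi_mul_sin_nonneg ?_ fun x hx y hy hxy => ?_)
  · rwa [integrableOn_Ioi_comp_mul_left_iff _ _ (inv_pos.2 hc), mul_zero]
  · exact ha (mul_pos (inv_pos.2 hc) hx) (mul_pos (inv_pos.2 hc) hy) (by gcongr)

theorem intervalIntegral_sin_mul {c : ℝ} (hc : c ≠ 0) (a : ℝ) :
    ∫ t in (0 : ℝ)..a, Real.sin (c * t) = (1 - Real.cos (c * a)) / c := by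
  rw [intervalIntegral.integral_comp_mul_left (fun y => Real.sin y) hc, integral_sin, mul_zero,
    Real.cos_zero, smul_eq_mul, inv_mul_eq_div]

theorem intervalIntegral_integral_Ioi_mul_sin (hg : IntegrableOn g (Ioi 0)) (c a : ℝ)
    (hc : c ≠ 0) :
    ∫ t in (0 : ℝ)..a, ∫ x in Ioi 0, g x * Real.sin (c * t * x) =
      ∫ x in Ioi 0, g x * ((1 - Real.cos (c * x * a)) / (c * x)) := by
  have hsin : Continuous fun p : ℝ × ℝ => Real.sin (c * p.1 * p.2) := by fun_prop
  have : IsFiniteMeasure (volume.restrict (uIoc 0 a)) :=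
    isFiniteMeasure_restrict.2 measure_Ioc_lt_top.ne
  have hint : Integrable (fun p : ℝ × ℝ => g p.2 * Real.sin (c * p.1 * p.2))
      ((volume.restrict (uIoc 0 a)).prod (volume.restrict (Ioi 0))) := by
    simpa only [one_mul] using ((integrable_const (1 : ℝ)).mul_prod hg).mul_bdd (c := 1)
      hsin.aestronglyMeasurable (ae_of_all _ fun p => Real.abs_sin_le_one _)
  rw [intervalIntegral_integral_swap hint]
  refine setIntegral_congr_fun measurableSet_Ioi fun x hx => ?_
  simp only [intervalIntegral.integral_const_mul, mul_right_comm c _ x,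
    intervalIntegral_sin_mul (mul_ne_zero hc (ne_of_gt hx))]

end SineTransform

section OddFourier

variable {q : ℝ → ℝ}

theorem norm_fourier_ofReal_neg (q : ℝ → ℝ) (t : ℝ) :
    ‖𝓕 (fun x => (q x : ℂ)) (-t)‖ = ‖𝓕 (fun x => (q x : ℂ)) t‖ := by
  rw [← conj_fourier_ofReal, RCLike.norm_conj]

theorem norm_fourier_ofReal_odd (hq : Integrable q) (ho : Function.Odd q)
    (ha : AntitoneOn q (Ioi 0)) {t : ℝ} (ht : 0 ≤ t) :
    ‖𝓕 (fun x => (q x : ℂ)) t‖ = 2 * ∫ x in Ioi 0, q x * Real.sin (2 * Real.pi * t * x) := by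
  have hhalf : ∫ x, q x * Real.sin (2 * Real.pi * (x * t)) =
      2 * ∫ x in Ioi 0, q x * Real.sin (2 * Real.pi * t * x) := by
    rw [← integral_comp_abs (f := fun x => q x * Real.sin (2 * Real.pi * t * x))]
    congr with x
    rcases abs_choice x with h | h
    · rw [h, mul_assoc _ t, mul_comm t]
    · rw [h, ho, mul_neg, Real.sin_neg, neg_mul_neg, mul_assoc _ t, mul_comm t]
  have hnonneg := integral_Ioi_mul_sin_mul_nonneg hq.integrableOn ha
    (mul_nonneg Real.two_pi_pos.le ht)
  have hI : 𝓕 (fun x => (q x : ℂ)) t = (𝓕 (fun x => (q x : ℂ)) t).im * I := by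
    refine Complex.ext ?_ ?_ <;> simp [re_fourier_ofReal_odd ho]
  rw [hI, norm_mul, Complex.norm_I, mul_one, Complex.norm_real, im_fourier_ofReal hq, norm_neg]
  simp only [Real.inner_apply]
  rw [hhalf, Real.norm_of_nonneg (by positivity)]

theorem eLpNorm_fourier_ofReal_odd (hq : Integrable q) (ho : Function.Odd q)
    (ha : AntitoneOn q (Ioi 0)) {a : ℝ} (ha0 : 0 ≤ a) :
    eLpNorm (𝓕 fun x => (q x : ℂ)) 1 (volume.restrict (Icc (-a) a)) =
      ENNReal.ofReal (4 * ∫ x in Ioi 0,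
        q x * ((1 - Real.cos (2 * Real.pi * x * a)) / (2 * Real.pi * x))) := by
  set Φ : ℝ → ℂ := 𝓕 fun x => (q x : ℂ)
  have hΦ : Continuous Φ := continuous_fourier_of_integrable hq.ofReal
  have hpos : ∫ t in (0 : ℝ)..a, ‖Φ t‖ = 2 * ∫ x in Ioi 0,
      q x * ((1 - Real.cos (2 * Real.pi * x * a)) / (2 * Real.pi * x)) := by
    rw [← intervalIntegral_integral_Ioi_mul_sin hq.integrableOn _ _ Real.two_pi_pos.ne',
      ← intervalIntegral.integral_const_mul]
    refine intervalIntegral.integral_congr fun t ht => norm_fourier_ofReal_odd hq ho ha ?_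
    rw [uIcc_of_le ha0] at ht
    exact ht.1
  have hneg : ∫ t in (-a)..0, ‖Φ t‖ = ∫ t in (0 : ℝ)..a, ‖Φ t‖ := by
    simpa only [neg_zero, Φ, norm_fourier_ofReal_neg] using
      (intervalIntegral.integral_comp_neg (a := 0) (b := a) fun t => ‖Φ t‖).symm
  have hsum := intervalIntegral.integral_add_adjacent_intervals
    (hΦ.norm.intervalIntegrable (μ := volume) (-a) 0) (hΦ.norm.intervalIntegrable 0 a)
  rw [eLpNorm_one_eq_lintegral_enorm,
    ← ofReal_integral_norm_eq_lintegral_enorm hΦ.continuousOn.integrableOn_Icc,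
    integral_Icc_eq_integral_Ioc, ← intervalIntegral.integral_of_le (neg_le_self ha0), ← hsum,
    hneg, hpos, ← add_mul]
  norm_num

theorem one_sub_cos_mul_div_le {c x : ℝ} (hc : 0 < c) (hx : 0 < x) (a : ℝ) :
    (1 - Real.cos (c * x * a)) / (c * x) ≤ c * a ^ 2 / 2 * x := by
  have hcos := Real.one_sub_sq_div_two_le_cos (x := c * x * a)
  rw [div_le_iff₀ (by positivity)]
  linarith

theorem one_sub_cos_mul_div_le_div {c x : ℝ} (hc : 0 < c) (hx : 0 < x) (a : ℝ) :
    (1 - Real.cos (c * x * a)) / (c * x) ≤ 2 / c / x := by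
  rw [div_div]
  gcongr
  linarith [Real.neg_one_le_cos (c * x * a)]

theorem ofReal_integral_Ioi_le {F G₁ G₂ : ℝ → ℝ} {a b : ℝ} (hab : a ≤ b)
    (hF : ∀ x ∈ Ioi a, 0 ≤ F x) (h₁ : ∀ x ∈ Ioc a b, F x ≤ G₁ x) (h₂ : ∀ x ∈ Ioi b, F x ≤ G₂ x) :
    ENNReal.ofReal (∫ x in Ioi a, F x) ≤
      (∫⁻ x in Ioc a b, ENNReal.ofReal (G₁ x)) + ∫⁻ x in Ioi b, ENNReal.ofReal (G₂ x) :=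
  calc ENNReal.ofReal (∫ x in Ioi a, F x)
      ≤ ∫⁻ x in Ioi a, ‖F x‖ₑ :=
        (Real.ofReal_le_enorm _).trans (enorm_integral_le_lintegral_enorm _)
    _ = ∫⁻ x in Ioi a, ENNReal.ofReal (F x) :=
        setLIntegral_congr_fun measurableSet_Ioi fun x hx => Real.enorm_of_nonneg (hF x hx)
    _ = (∫⁻ x in Ioc a b, ENNReal.ofReal (F x)) + ∫⁻ x in Ioi b, ENNReal.ofReal (F x) := by
        rw [← Ioc_union_Ioi_eq_Ioi hab,
          lintegral_union measurableSet_Ioi (Ioc_disjoint_Ioi le_rfl)]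
    _ ≤ _ := add_le_add
        (setLIntegral_mono' measurableSet_Ioc fun x hx => ENNReal.ofReal_le_ofReal (h₁ x hx))
        (setLIntegral_mono' measurableSet_Ioi fun x hx => ENNReal.ofReal_le_ofReal (h₂ x hx))

theorem eLpNorm_fourier_ofReal_odd_le (hq : Integrable q) (ho : Function.Odd q)
    (ha : AntitoneOn q (Ioi 0)) (hpos : ∀ x, 0 < x → 0 ≤ q x) {a : ℝ} (ha0 : 0 ≤ a) {α : ℝ}
    (hα : 0 ≤ α) :
    eLpNorm (𝓕 fun x => (q x : ℂ)) 1 (volume.restrict (Icc (-a) a)) ≤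
      ENNReal.ofReal (4 * Real.pi * a ^ 2) * (∫⁻ x in Ioc 0 α, ENNReal.ofReal (q x * x)) +
        ENNReal.ofReal (4 / Real.pi) * ∫⁻ x in Ioi α, ENNReal.ofReal (q x / x) := by
  let F (x : ℝ) : ℝ := 4 * (q x * ((1 - Real.cos (2 * Real.pi * x * a)) / (2 * Real.pi * x)))
  have hF_nonneg (x : ℝ) (hx : x ∈ Ioi 0) : 0 ≤ F x := by
    have hx0 : 0 < x := hx
    have := hpos x hx
    have := sub_nonneg.2 (Real.cos_le_one (2 * Real.pi * x * a))
    positivity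
  have hF_near (x : ℝ) (hx : x ∈ Ioc 0 α) : F x ≤ 4 * Real.pi * a ^ 2 * (q x * x) :=
    calc F x ≤ 4 * (q x * (2 * Real.pi * a ^ 2 / 2 * x)) :=
        mul_le_mul_of_nonneg_left (mul_le_mul_of_nonneg_left
          (one_sub_cos_mul_div_le Real.two_pi_pos hx.1 a) (hpos x hx.1)) zero_le_four
      _ = 4 * Real.pi * a ^ 2 * (q x * x) := by ring
  have hF_far (x : ℝ) (hx : x ∈ Ioi α) : F x ≤ 4 / Real.pi * (q x / x) :=
    calc F x ≤ 4 * (q x * (2 / (2 * Real.pi) / x)) :=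
        mul_le_mul_of_nonneg_left (mul_le_mul_of_nonneg_left
          (one_sub_cos_mul_div_le_div Real.two_pi_pos (hα.trans_lt hx) a)
          (hpos x (hα.trans_lt hx))) zero_le_four
      _ = 4 / Real.pi * (q x / x) := by field_simp
  rw [eLpNorm_fourier_ofReal_odd hq ho ha ha0, ← integral_const_mul,
    ← lintegral_const_mul' _ _ ENNReal.ofReal_ne_top,
    ← lintegral_const_mul' _ _ ENNReal.ofReal_ne_top]
  simp only [← ENNReal.ofReal_mul (show (0 : ℝ) ≤ 4 * Real.pi * a ^ 2 by positivity),
    ← ENNReal.ofReal_mul (show (0 : ℝ) ≤ 4 / Real.pi by positivity)]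
  exact ofReal_integral_Ioi_le hα hF_nonneg hF_near hF_far

end OddFourier

section PathConst

variable {m : ℕ} {Q : ℝ → ℝ}

theorem odd_spectralWeight (hQ : Function.Even Q) : Function.Odd (spectralWeight m Q) := by
  intro x
  rw [spectralWeight, spectralWeight, mul_neg, (even_two_mul m).neg_pow, hQ, neg_mul, neg_mul,
    one_div_neg_eq_neg_one_div]

theorem spectralWeight_nonneg {x : ℝ} (hx : 0 ≤ x) (hQ : 0 ≤ Q x) : 0 ≤ spectralWeight m Q x := by
  unfold spectralWeight
  positivity

theorem pathConst_lt_top (hR : Integrable (spectralWeight m Q)) (T : ℝ) :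
    pathConst m Q T < ∞ :=
  (memLp_one_iff_integrable.2
    (continuous_fourier_of_integrable hR.ofReal).continuousOn.integrableOn_Icc.integrable).2

theorem pathConst_le (hQ_pos : ∀ x, 0 < x → 0 ≤ Q x) (hQ : Function.Even Q)
    (hR : Integrable (spectralWeight m Q)) (ha : AntitoneOn (spectralWeight m Q) (Ioi 0)) {T : ℝ}
    (hT : 0 ≤ T + 1) {α : ℝ} (hα : 0 ≤ α) :
    pathConst m Q T ≤
      ENNReal.ofReal (4 * Real.pi * (T + 1) ^ 2) *
          (∫⁻ x in Ioc 0 α, ENNReal.ofReal (spectralWeight m Q x * x)) +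
        ENNReal.ofReal (4 / Real.pi) *
          ∫⁻ x in Ioi α, ENNReal.ofReal (spectralWeight m Q x / x) := by
  rw [pathConst, ← neg_add']
  exact eLpNorm_fourier_ofReal_odd_le hR (odd_spectralWeight hQ) ha
    (fun x hx => spectralWeight_nonneg hx.le (hQ_pos x hx)) hT hα

end PathConst

theorem mainTheorem3 (m : ℕ) (hm : 1 ≤ m) (Q : ℝ → ℝ)
    (hQ_int : Integrable Q) (hQ_pos : ∀ x : ℝ, x ≠ 0 → 0 < Q x)
    (hQ_even : ∀ x : ℝ, Q (-x) = Q x)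
    (hR_int : Integrable (spectralWeight m Q)) :
    -- the Fourier integral defining the kernel is real, and `k` is a translation-invariant
    -- universal kernel with `k(t,t) ≤ ‖Q‖` in `L¹`
    (∀ s t : ℝ, ((spectralKernel Q s t : ℝ) : ℂ) = 𝓕 (fun ω : ℝ => (Q ω : ℂ)) (s - t)) ∧
    (Matrix.of (spectralKernel Q)).PosSemidef ∧
    (∀ s t h : ℝ, spectralKernel Q (s + h) (t + h) = spectralKernel Q s t) ∧
    IsUniversalKernel (spectralKernel Q) ∧
    (∀ t : ℝ, spectralKernel Q t t ≤ ∫ ω, |Q ω|) ∧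
    -- the RKHS of `k`
    (∀ (H : Type*) [NormedAddCommGroup H] [InnerProductSpace ℝ H] [CompleteSpace H]
        [RKHS ℝ H ℝ ℝ], HasKernel H (spectralKernel Q) →
      (∀ f : ℝ → ℝ, HasCompactSupport f → TimesDifferentiable (2 * m) f →
        (∀ j ≤ 2 * m, ∃ C : ℝ, ∀ t : ℝ, |iteratedDeriv j f t| ≤ C) →
        ∃ F : H, ∀ t : ℝ, F t = f t) ∧
      (∀ T : ℝ, 0 < T → ∀ f : ℝ → ℝ, TimesDifferentiable (2 * m) f →
        Function.support f ⊆ Icc 0 (T + 1) →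
        ∀ F : H, (∀ t : ℝ, F t = f t) →
          ENNReal.ofReal (‖F‖ ^ 2) ≤ pathConst m Q T * eLpNorm (deriv f) 1 volume *
            eLpNorm (fun t => f t + (-1) ^ m * iteratedDeriv (2 * m) f t) ∞ volume)) ∧
    -- the constant `c(T)`
    (∀ T : ℝ, 0 < T → pathConst m Q T < ∞) ∧
    (AntitoneOn (spectralWeight m Q) (Ioi 0) → ∀ T : ℝ, 0 < T →
      pathConst m Q T ≤ ⨅ (α : ℝ) (_ : 0 < α),
        (ENNReal.ofReal (4 * Real.pi * (T + 1) ^ 2) *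
            (∫⁻ x in Ioc 0 α, ENNReal.ofReal (spectralWeight m Q x * x)) +
          ENNReal.ofReal (4 / Real.pi) *
            ∫⁻ x in Ioi α, ENNReal.ofReal (spectralWeight m Q x / x))) := by
  have hQ_pos_ae : ∀ᵐ x, 0 < Q x := (Measure.ae_ne volume 0).mono hQ_pos
  refine ⟨ofReal_spectralKernel hQ_even,
    posSemidef_spectralKernel hQ_int (hQ_pos_ae.mono fun _ hx => hx.le),
    spectralKernel_add_add Q, isUniversalKernel_spectralKernel hQ_int hQ_even hQ_pos_ae,
    fun t => spectralKernel_le Q t t, fun H _ _ _ _ hk => ⟨fun f hc hd hb => ?_, ?_⟩,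
    fun T _ => pathConst_lt_top hR_int T, fun ha T hT => le_iInf₂ fun α hα => ?_⟩
  · obtain ⟨C, hC⟩ := hb (2 * m) le_rfl
    obtain ⟨F, hF, -⟩ := hk.exists_norm_sq_le_spectralEnergy hm hQ_int hQ_pos_ae hR_int
      (HasIntegrableDerivs.of_bounded (by omega) hd hc hC)
    exact ⟨F, hF⟩
  · intro T hT f hd hsupp F hF
    exact hk.ofReal_norm_sq_le hm hQ_int hQ_pos_ae hR_int (by positivity) hd hsupp hF
  · exact pathConst_le (fun x hx => (hQ_pos x hx.ne').le) hQ_even hR_int ha (by positivity) hα.le
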